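/- Let $\mathbb{N}^\times$ be the category with a single object $*$ whose endomorphisms are the positive integers under multiplication, and let $\widehat{\mathbb{N}^\times}$ be the topos of contravariant functors from $\mathbb{N}^\times$ to sets. Let $\overline{\mathbb{N}}=(\mathbb{N}\cup\{\infty\},\inf,+)$, with $\mathbb{N}=\mathbb{Z}_{\ge 0}$, be the semiring whose addition is $\inf$ and whose multiplication is $+$; with the positive integers acting by multiplication it is a semiring object of $\widehat{\mathbb{N}^\times}$ (the structure sheaf of the arithmetic site). Let $\mathbb{Q}_{\max}=(\mathbb{Q}\cup\{-\infty\},\max,+)$ and $\mathbb{Z}_{\max}=(\mathbb{Z}\cup\{-\infty\},\max,+)$ be the tropical semifields; write $\vee$ for their addition, $0=-\infty$ for its neutral element, and use multiplicative notation for their multiplication, so that $1$ is the rational number zero. Let $K$ be an intermediate semifield $\mathbb{Z}_{\max}\subset K\subset\mathbb{Q}_{\max}$. The point of $\widehat{\mathbb{N}^\times}$ associated to $K$ is the geometric morphism from sets to $\widehat{\mathbb{N}^\times}$ given by the flat functor which sends $*$ to the set $K_{>1}=\{x\in K\mid x\vee 1=x,\ x\neq 1\}$ of strictly positive elements of the totally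 ordered group $K\setminus\{0\}$, the positive integer $n$ acting by $x\mapsto x^n$ (multiplication by $n$ in additive notation). Theorem. The stalk of the structure sheaf $\overline{\mathbb{N}}$ at the point of $\widehat{\mathbb{N}^\times}$ associated to $K$, with the semiring structure inherited from $\overline{\mathbb{N}}$ through the inverse image functor, is canonically isomorphic to the semiring $$\mathcal{O}_K=\{r\in K\mid r\vee 1=1\},$$ by an isomorphism which sends the germ at $x\in K_{>1}$ of $n\in\mathbb{N}$ to $x^{-n}$. -/

import Mathlib

open CategoryTheory Limits Opposite MonoidalCategory CartesianMonoidalCategory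

noncomputable section

/-! ### The tropical semifields -/

/-- The tropical semifield `ℚ_max`: the set `ℚ ∪ {-∞}` whose addition is `max` and whose
multiplication is the addition of rational numbers. Thus `0 = -∞` and `1` is the rational
number zero. -/
def Qmax : Type := WithBot ℚ

namespace Qmax

/-- The element of `ℚ_max` given by a rational number. -/
def ofRat (q : ℚ) : Qmax := (q : WithBot ℚ)

instance : Zero Qmax := ⟨(⊥ : WithBot ℚ)⟩
instance : One Qmax := ⟨ofRat 0⟩
instance : Add Qmax := ⟨fun x y => max (α := WithBot ℚ) x y⟩
instance : Mul Qmax := ⟨fun x y => HAdd.hAdd (α := WithBot ℚ) (β := WithBot ℚ) x y⟩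
instance : Inv Qmax := ⟨fun x => WithBot.map (fun q : ℚ => -q) x⟩

theorem cases (x : Qmax) : x = 0 ∨ ∃ q, x = ofRat q := by
  rcases x with _ | q
  · exact Or.inl rfl
  · exact Or.inr ⟨q, rfl⟩

theorem ofRat_add (a b : ℚ) : ofRat a + ofRat b = ofRat (max a b) :=
  (WithBot.coe_max a b).symm

theorem ofRat_mul (a b : ℚ) : ofRat a * ofRat b = ofRat (a + b) := rfl

theorem ofRat_inv (a : ℚ) : (ofRat a)⁻¹ = ofRat (-a) := rfl

theorem one_def : (1 : Qmax) = ofRat 0 := rfl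

theorem ofRat_injective : Function.Injective ofRat := WithBot.coe_injective

theorem ofRat_ne_zero (a : ℚ) : ofRat a ≠ 0 := WithBot.coe_ne_bot

instance : CommSemiring Qmax where
  add_assoc := max_assoc (α := WithBot ℚ)
  zero_add := bot_sup_eq (α := WithBot ℚ)
  add_zero := sup_bot_eq (α := WithBot ℚ)
  add_comm := max_comm (α := WithBot ℚ)
  nsmul := nsmulRec
  mul_assoc := add_assoc (G := WithBot ℚ)
  one_mul := zero_add (M := WithBot ℚ)
  mul_one := add_zero (M := WithBot ℚ)
  mul_comm := add_comm (G := WithBot ℚ)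
  zero_mul := WithBot.bot_add
  mul_zero := WithBot.add_bot
  left_distrib a b c := (max_add_add_left (α := WithBot ℚ) a b c).symm
  right_distrib a b c := (max_add_add_right (α := WithBot ℚ) a b c).symm

instance : Semifield Qmax where
  exists_pair_ne := ⟨0, 1, WithBot.bot_ne_coe⟩
  inv_zero := rfl
  mul_inv_cancel x hx := by
    rcases cases x with rfl | ⟨q, rfl⟩
    · exact absurd rfl hx
    · rw [ofRat_inv, ofRat_mul, add_neg_cancel]; rfl
  nnqsmul := _
  nnqsmul_def := fun _ _ => rfl

theorem ofRat_pow (a : ℚ) (n : ℕ) : ofRat a ^ n = ofRat (n * a) := by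
  induction n with
  | zero => simp [one_def]
  | succ k ih => rw [pow_succ, ih, ofRat_mul]; push_cast; ring_nf

end Qmax

/-- The semifield `ℤ_max`, that is `ℤ ∪ {-∞}`, inside `ℚ_max`. -/
def Zmax : Subsemiring Qmax where
  carrier := {x | x = 0 ∨ ∃ m : ℤ, x = Qmax.ofRat m}
  zero_mem' := Or.inl rfl
  one_mem' := Or.inr ⟨0, by simp [Qmax.one_def]⟩
  add_mem' := by
    rintro _ _ (rfl | ⟨m, rfl⟩) (rfl | ⟨n, rfl⟩)
    · exact Or.inl (add_zero _)
    · exact Or.inr ⟨n, zero_add _⟩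
    · exact Or.inr ⟨m, add_zero _⟩
    · exact Or.inr ⟨max m n, by rw [Qmax.ofRat_add, Int.cast_max]⟩
  mul_mem' := by
    rintro _ _ (rfl | ⟨m, rfl⟩) (rfl | ⟨n, rfl⟩)
    · exact Or.inl (zero_mul _)
    · exact Or.inl (zero_mul _)
    · exact Or.inl (mul_zero _)
    · exact Or.inr ⟨m + n, by rw [Qmax.ofRat_mul, Int.cast_add]⟩

/-- An intermediate semifield `ℤ_max ⊆ K ⊆ ℚ_max`. -/
structure IntermediateSemifield extends Subsemiring Qmax where
  inv_mem' : ∀ x ∈ carrier, x⁻¹ ∈ carrier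
  Zmax_le' : ∀ x ∈ Zmax, x ∈ carrier

namespace IntermediateSemifield

/-- The semiring `O_K = {r ∈ K | r ∨ 1 = 1}`, where `∨` is the addition of `K`. -/
def integers (K : IntermediateSemifield) : Subsemiring Qmax where
  carrier := {r | r ∈ K.toSubsemiring ∧ r + 1 = 1}
  zero_mem' := ⟨zero_mem _, zero_add _⟩
  one_mem' := ⟨one_mem _, max_self (α := WithBot ℚ) _⟩
  add_mem' := by
    rintro a b ⟨ha, ha'⟩ ⟨hb, hb'⟩
    exact ⟨add_mem ha hb, by rw [add_assoc, hb', ha']⟩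
  mul_mem' := by
    rintro a b ⟨ha, ha'⟩ ⟨hb, hb'⟩
    refine ⟨mul_mem ha hb, ?_⟩
    calc a * b + 1 = a * b + (b + 1) := by rw [hb']
      _ = (a + 1) * b + 1 := by ring
      _ = 1 := by rw [ha', one_mul, hb']

/-- The elements `x > 1` of `K` (for the order `x ≤ y ↔ x ∨ y = y`); they form the strictly
positive part of the totally ordered group of nonzero elements of `K`. -/
def PositivePart (K : IntermediateSemifield) : Type :=
  {x : Qmax // x ∈ K.toSubsemiring ∧ x + 1 = x ∧ x ≠ 1}

theorem positive_iff (K : IntermediateSemifield) (x : Qmax) :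
    (x ∈ K.toSubsemiring ∧ x + 1 = x ∧ x ≠ 1) ↔
      ∃ q : ℚ, 0 < q ∧ x = Qmax.ofRat q ∧ Qmax.ofRat q ∈ K.toSubsemiring := by
  constructor
  · rintro ⟨hx, h1, h2⟩
    rcases Qmax.cases x with rfl | ⟨q, rfl⟩
    · rw [zero_add] at h1
      exact absurd h1.symm h2
    · refine ⟨q, ?_, rfl, hx⟩
      rw [Qmax.one_def, Qmax.ofRat_add] at h1
      have h3 : 0 ≤ q := max_eq_left_iff.1 (Qmax.ofRat_injective h1)
      refine lt_of_le_of_ne h3 ?_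
      rintro rfl
      exact h2 rfl
  · rintro ⟨q, hq, rfl, hx⟩
    refine ⟨hx, ?_, ?_⟩
    · rw [Qmax.one_def, Qmax.ofRat_add, max_eq_left hq.le]
    · intro h
      exact hq.ne' (Qmax.ofRat_injective h)

/-- The action of the positive integers on the positive part of `K`: in additive notation it
is the multiplication by `n`, in the notation of the semifield it is `x ↦ x ^ n`. -/
def PositivePart.pow {K : IntermediateSemifield} (x : K.PositivePart) (n : ℕ+) :
    K.PositivePart :=
  ⟨x.1 ^ (n : ℕ), (K.positive_iff _).2 (by
    obtain ⟨q, hq, hx, hK⟩ := (K.positive_iff _).1 x.2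
    refine ⟨n * q, by positivity, ?_, ?_⟩
    · rw [hx, Qmax.ofRat_pow]
    · rw [← Qmax.ofRat_pow]
      exact pow_mem hK _)⟩

end IntermediateSemifield

/-! ### Points of a presheaf topos and stalks of presheaves of semirings -/

/-- A point of the topos of presheaves of sets on `C`: a geometric morphism from the topos of
sets, that is a functor (the inverse image) which preserves finite limits and has a right
adjoint (the direct image). -/
structure ToposPoint (C : Type) [SmallCategory C] where
  inverseImage : (Cᵒᵖ ⥤ Type) ⥤ Type
  directImage : Type ⥤ (Cᵒᵖ ⥤ Type)
  adj : inverseImage ⊣ directImage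
  preservesFiniteLimits : PreservesFiniteLimits inverseImage

namespace ToposPoint

variable {C : Type} [SmallCategory C]

attribute [instance] ToposPoint.preservesFiniteLimits

/-- The point of the presheaf topos given by a point of the site whose topology is trivial
(that is, by a flat functor `C ⥤ Type`). -/
def ofSite (Φ : (⊥ : GrothendieckTopology C).Point) : ToposPoint C where
  inverseImage := Φ.presheafFiber
  directImage := Φ.skyscraperPresheafFunctor
  adj := Φ.skyscraperPresheafAdjunction
  preservesFiniteLimits := inferInstance

variable (p : ToposPoint C)

theorem bijective_pair (F G : Cᵒᵖ ⥤ Type) :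
    Function.Bijective (fun z : p.inverseImage.obj (F ⊗ G) =>
      (p.inverseImage.map (fst F G) z, p.inverseImage.map (snd F G) z)) := by
  have h := mapIsLimitOfPreservesOfIsLimit p.inverseImage _ _ (tensorProductIsBinaryProduct F G)
  let e := h.conePointUniqueUpToIso (Types.binaryProductLimit _ _)
  have h1 := h.conePointUniqueUpToIso_hom_comp (Types.binaryProductLimit _ _) ⟨WalkingPair.left⟩
  have h2 := h.conePointUniqueUpToIso_hom_comp (Types.binaryProductLimit _ _) ⟨WalkingPair.right⟩
  have he : Function.Bijective e.hom := (isIso_iff_bijective e.hom).1 inferInstance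
  have key : (fun z : p.inverseImage.obj (F ⊗ G) =>
      (p.inverseImage.map (fst F G) z, p.inverseImage.map (snd F G) z)) = e.hom := by
    funext z
    exact Prod.ext (ConcreteCategory.congr_hom h1 z).symm (ConcreteCategory.congr_hom h2 z).symm
  rw [key]
  exact he

/-- The bijection `p^*(F × G) ≃ p^*(F) × p^*(G)`. -/
def prodEquiv (F G : Cᵒᵖ ⥤ Type) :
    p.inverseImage.obj (F ⊗ G) ≃ p.inverseImage.obj F × p.inverseImage.obj G :=
  Equiv.ofBijective _ (p.bijective_pair F G)

/-- The set `p^*(1)` has exactly one element. -/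
theorem nonempty_unique :
    Nonempty (Unique (p.inverseImage.obj (𝟙_ (Cᵒᵖ ⥤ Type)))) :=
  ⟨Types.isTerminalEquivUnique _
    (IsTerminal.isTerminalObj p.inverseImage _ isTerminalTensorUnit)⟩

/-- The unique element of `p^*(1)`. -/
def unit : p.inverseImage.obj (𝟙_ (Cᵒᵖ ⥤ Type)) := p.nonempty_unique.some.default

end ToposPoint

/-- The presheaf of sets underlying a presheaf of commutative semirings. -/
abbrev underlying {C : Type} [SmallCategory C] (R : Cᵒᵖ ⥤ CommSemiRingCat.{0}) : Cᵒᵖ ⥤ Type :=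
  R ⋙ forget CommSemiRingCat

namespace InternalSemiring

variable {C : Type} [SmallCategory C] (R : Cᵒᵖ ⥤ CommSemiRingCat.{0})

/-- The addition `R × R ⟶ R`, a morphism of presheaves of sets. -/
def addHom : underlying R ⊗ underlying R ⟶ underlying R where
  app X := TypeCat.ofHom fun z : R.obj X × R.obj X => z.1 + z.2
  naturality X Y f := by
    ext z
    exact (map_add (R.map f).hom z.1 z.2).symm

/-- The multiplication `R × R ⟶ R`, a morphism of presheaves of sets. -/
def mulHom : underlying R ⊗ underlying R ⟶ underlying R where
  app X := TypeCat.ofHom fun z : R.obj X × R.obj X => z.1 * z.2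
  naturality X Y f := by
    ext z
    exact (map_mul (R.map f).hom z.1 z.2).symm

/-- The zero section `1 ⟶ R`. -/
def zeroHom : 𝟙_ (Cᵒᵖ ⥤ Type) ⟶ underlying R where
  app X := TypeCat.ofHom fun _ => (0 : R.obj X)
  naturality X Y f := by
    ext z
    exact (map_zero (R.map f).hom).symm

/-- The unit section `1 ⟶ R`. -/
def oneHom : 𝟙_ (Cᵒᵖ ⥤ Type) ⟶ underlying R where
  app X := TypeCat.ofHom fun _ => (1 : R.obj X)
  naturality X Y f := by
    ext z
    exact (map_one (R.map f).hom).symm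

end InternalSemiring

open InternalSemiring

namespace ToposPoint

variable {C : Type} [SmallCategory C] (p : ToposPoint C) (R : Cᵒᵖ ⥤ CommSemiRingCat.{0})

/-- The stalk `p^*(R)` of a presheaf of semirings at a point of the topos. -/
def Stalk : Type := p.inverseImage.obj (underlying R)

namespace Stalk

/-! The operations of the stalk are the images under `p^*` of those of the semiring object `R`
of the topos, through `p^*(R × R) = p^*(R) × p^*(R)` and `p^*(1) = 1`. -/

instance : Add (p.Stalk R) :=
  ⟨fun a b => p.inverseImage.map (addHom R) ((p.prodEquiv _ _).symm (a, b))⟩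
instance : Mul (p.Stalk R) :=
  ⟨fun a b => p.inverseImage.map (mulHom R) ((p.prodEquiv _ _).symm (a, b))⟩
instance : Zero (p.Stalk R) := ⟨p.inverseImage.map (zeroHom R) p.unit⟩
instance : One (p.Stalk R) := ⟨p.inverseImage.map (oneHom R) p.unit⟩

variable {R}

/-- The element of the stalk of `R` given by a generalized element of `R`. -/
def gen {G : Cᵒᵖ ⥤ Type} (z : p.inverseImage.obj G) (f : G ⟶ underlying R) : p.Stalk R :=
  p.inverseImage.map f z

variable {p}

theorem prodEquiv_symm_gen {G : Cᵒᵖ ⥤ Type} (z : p.inverseImage.obj G)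
    (f g : G ⟶ underlying R) :
    (p.prodEquiv _ _).symm (gen p z f, gen p z g) = p.inverseImage.map (lift f g) z := by
  rw [Equiv.symm_apply_eq]
  refine Prod.ext ?_ ?_
  · change p.inverseImage.map f z = p.inverseImage.map (fst _ _) (p.inverseImage.map (lift f g) z)
    rw [← ConcreteCategory.comp_apply, ← Functor.map_comp, lift_fst]
  · change p.inverseImage.map g z = p.inverseImage.map (snd _ _) (p.inverseImage.map (lift f g) z)
    rw [← ConcreteCategory.comp_apply, ← Functor.map_comp, lift_snd]

theorem gen_add {G : Cᵒᵖ ⥤ Type} (z : p.inverseImage.obj G) (f g : G ⟶ underlying R) :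
    gen p z f + gen p z g = gen p z (lift f g ≫ addHom R) := by
  change p.inverseImage.map (addHom R) ((p.prodEquiv _ _).symm (gen p z f, gen p z g)) = _
  rw [prodEquiv_symm_gen, gen, Functor.map_comp, ConcreteCategory.comp_apply]

theorem gen_mul {G : Cᵒᵖ ⥤ Type} (z : p.inverseImage.obj G) (f g : G ⟶ underlying R) :
    gen p z f * gen p z g = gen p z (lift f g ≫ mulHom R) := by
  change p.inverseImage.map (mulHom R) ((p.prodEquiv _ _).symm (gen p z f, gen p z g)) = _
  rw [prodEquiv_symm_gen, gen, Functor.map_comp, ConcreteCategory.comp_apply]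

theorem map_toUnit {G : Cᵒᵖ ⥤ Type} (z : p.inverseImage.obj G) :
    p.inverseImage.map (toUnit G) z = p.unit := by
  obtain ⟨h⟩ := p.nonempty_unique
  exact Subsingleton.elim _ _

theorem zero_eq_gen {G : Cᵒᵖ ⥤ Type} (z : p.inverseImage.obj G) :
    (0 : p.Stalk R) = gen p z (toUnit G ≫ zeroHom R) := by
  rw [gen, Functor.map_comp, ConcreteCategory.comp_apply, map_toUnit]; rfl

theorem one_eq_gen {G : Cᵒᵖ ⥤ Type} (z : p.inverseImage.obj G) :
    (1 : p.Stalk R) = gen p z (toUnit G ≫ oneHom R) := by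
  rw [gen, Functor.map_comp, ConcreteCategory.comp_apply, map_toUnit]; rfl

theorem exists_gen₃ (a b c : p.Stalk R) : ∃ (G : Cᵒᵖ ⥤ Type) (z : p.inverseImage.obj G)
    (f g h : G ⟶ underlying R), a = gen p z f ∧ b = gen p z g ∧ c = gen p z h := by
  let F := underlying R
  let y := (p.prodEquiv F F).symm (b, c)
  let z := (p.prodEquiv F (F ⊗ F)).symm (a, y)
  have hz := (p.prodEquiv F (F ⊗ F)).apply_symm_apply (a, y)
  have hy := (p.prodEquiv F F).apply_symm_apply (b, c)
  have hz1 : p.inverseImage.map (fst _ _) z = a := congrArg Prod.fst hz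
  have hz2 : p.inverseImage.map (snd _ _) z = y := congrArg Prod.snd hz
  have hy1 : p.inverseImage.map (fst _ _) y = b := congrArg Prod.fst hy
  have hy2 : p.inverseImage.map (snd _ _) y = c := congrArg Prod.snd hy
  refine ⟨_, z, fst _ _, snd _ _ ≫ fst _ _, snd _ _ ≫ snd _ _, hz1.symm, ?_, ?_⟩
  · rw [gen, Functor.map_comp, ConcreteCategory.comp_apply, hz2, hy1]
  · rw [gen, Functor.map_comp, ConcreteCategory.comp_apply, hz2, hy2]

theorem gen_congr {G : Cᵒᵖ ⥤ Type} (z : p.inverseImage.obj G) {f g : G ⟶ underlying R}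
    (h : ∀ X (s : G.obj X), (f.app X s : R.obj X) = g.app X s) : gen p z f = gen p z g := by
  have : f = g := by
    ext X s
    exact h X s
  rw [this]

instance : CommSemiring (p.Stalk R) where
  add_assoc a b c := by
    obtain ⟨G, z, f, g, h, rfl, rfl, rfl⟩ := exists_gen₃ a b c
    simp only [gen_add]
    exact gen_congr z fun X s =>
      add_assoc (f.app X s : R.obj X) (g.app X s : R.obj X) (h.app X s : R.obj X)
  zero_add a := by
    obtain ⟨G, z, f, -, -, rfl, -, -⟩ := exists_gen₃ a a a
    rw [zero_eq_gen z, gen_add]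
    exact gen_congr z fun X s => zero_add (f.app X s : R.obj X)
  add_zero a := by
    obtain ⟨G, z, f, -, -, rfl, -, -⟩ := exists_gen₃ a a a
    rw [zero_eq_gen z, gen_add]
    exact gen_congr z fun X s => add_zero (f.app X s : R.obj X)
  add_comm a b := by
    obtain ⟨G, z, f, g, -, rfl, rfl, -⟩ := exists_gen₃ a b b
    simp only [gen_add]
    exact gen_congr z fun X s => add_comm (f.app X s : R.obj X) (g.app X s : R.obj X)
  nsmul := nsmulRec
  mul_assoc a b c := by
    obtain ⟨G, z, f, g, h, rfl, rfl, rfl⟩ := exists_gen₃ a b c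
    simp only [gen_mul]
    exact gen_congr z fun X s =>
      mul_assoc (f.app X s : R.obj X) (g.app X s : R.obj X) (h.app X s : R.obj X)
  one_mul a := by
    obtain ⟨G, z, f, -, -, rfl, -, -⟩ := exists_gen₃ a a a
    rw [one_eq_gen z, gen_mul]
    exact gen_congr z fun X s => one_mul (f.app X s : R.obj X)
  mul_one a := by
    obtain ⟨G, z, f, -, -, rfl, -, -⟩ := exists_gen₃ a a a
    rw [one_eq_gen z, gen_mul]
    exact gen_congr z fun X s => mul_one (f.app X s : R.obj X)
  mul_comm a b := by
    obtain ⟨G, z, f, g, -, rfl, rfl, -⟩ := exists_gen₃ a b b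
    simp only [gen_mul]
    exact gen_congr z fun X s => mul_comm (f.app X s : R.obj X) (g.app X s : R.obj X)
  zero_mul a := by
    obtain ⟨G, z, f, -, -, rfl, -, -⟩ := exists_gen₃ a a a
    rw [zero_eq_gen z, gen_mul]
    exact gen_congr z fun X s => zero_mul (f.app X s : R.obj X)
  mul_zero a := by
    obtain ⟨G, z, f, -, -, rfl, -, -⟩ := exists_gen₃ a a a
    rw [zero_eq_gen z, gen_mul]
    exact gen_congr z fun X s => mul_zero (f.app X s : R.obj X)
  left_distrib a b c := by
    obtain ⟨G, z, f, g, h, rfl, rfl, rfl⟩ := exists_gen₃ a b c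
    simp only [gen_add, gen_mul]
    exact gen_congr z fun X s =>
      mul_add (f.app X s : R.obj X) (g.app X s : R.obj X) (h.app X s : R.obj X)
  right_distrib a b c := by
    obtain ⟨G, z, f, g, h, rfl, rfl, rfl⟩ := exists_gen₃ a b c
    simp only [gen_add, gen_mul]
    exact gen_congr z fun X s =>
      add_mul (f.app X s : R.obj X) (g.app X s : R.obj X) (h.app X s : R.obj X)

end Stalk

end ToposPoint

/-! ### The arithmetic site -/

/-- The category with one object whose endomorphisms are the positive integers under
multiplication. -/
abbrev NCat : Type := SingleObj ℕ+

/-- The semiring `(ℕ ∪ {∞}, inf, +)`: its addition is `inf` and its multiplication is `+`. -/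
abbrev Nbar : Type := Tropical (WithTop ℕ)

/-- The endomorphism of `(ℕ ∪ {∞}, inf, +)` given by multiplication by the positive
integer `n`. -/
def Nbar.scale (n : ℕ+) : Nbar →+* Nbar where
  toFun x := Tropical.trop ((n : ℕ) • Tropical.untrop x)
  map_zero' := by
    obtain ⟨k, hk⟩ := Nat.exists_eq_succ_of_ne_zero n.ne_zero
    rw [hk]
    change Tropical.trop ((k.succ) • (⊤ : WithTop ℕ)) = Tropical.trop ⊤
    rw [succ_nsmul, add_top]
  map_one' := by
    change Tropical.trop ((n : ℕ) • (0 : WithTop ℕ)) = Tropical.trop 0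
    rw [nsmul_zero]
  map_add' x y := (Tropical.add_pow x y n)
  map_mul' x y := (mul_pow x y (n : ℕ))

/-- The structure sheaf of the arithmetic site: the semiring `(ℕ ∪ {∞}, inf, +)` on which the
positive integers act by multiplication. -/
def structureSheaf : NCatᵒᵖ ⥤ CommSemiRingCat.{0} where
  obj _ := CommSemiRingCat.of Nbar
  map f := CommSemiRingCat.ofHom (Nbar.scale f.unop)
  map_id X := by
    ext x
    exact congrArg Tropical.trop (one_nsmul (Tropical.untrop x))
  map_comp f g := by
    ext x
    exact congrArg Tropical.trop (mul_nsmul (Tropical.untrop x) (f.unop : ℕ+) (g.unop : ℕ+))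

namespace IntermediateSemifield

variable (K : IntermediateSemifield)

/-- The covariant action of the positive integers on the positive part of `K`. -/
def positiveFunctor : NCat ⥤ Type where
  obj _ := K.PositivePart
  map n := TypeCat.ofHom fun x => x.pow n
  map_id X := by
    ext x
    exact Subtype.ext (pow_one x.1)
  map_comp f g := by
    ext x
    have h (m n : ℕ+) : x.pow (n * m) = (x.pow m).pow n :=
      Subtype.ext (by simp [PositivePart.pow, ← pow_mul, mul_comm])
    exact h f g

theorem ofRat_int_mul_mem (q : ℚ) (hq : Qmax.ofRat q ∈ K.toSubsemiring) (m : ℤ) :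
    Qmax.ofRat (m * q) ∈ K.toSubsemiring := by
  have h : ∀ n : ℕ, Qmax.ofRat (n * q) ∈ K.toSubsemiring := fun n => by
    rw [← Qmax.ofRat_pow]
    exact pow_mem hq n
  obtain ⟨n, rfl | rfl⟩ := m.eq_nat_or_neg
  · exact_mod_cast h n
  · have := K.inv_mem' _ (h n)
    rw [Qmax.ofRat_inv] at this
    simpa using this

/-- Two elements of the positive part of `K` have a common root in it. -/
theorem exists_common_root (x y : K.PositivePart) :
    ∃ (z : K.PositivePart) (m n : ℕ+), z.pow m = x ∧ z.pow n = y := by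
  obtain ⟨a, ha, hax, haK⟩ := (K.positive_iff _).1 x.2
  obtain ⟨b, hb, hby, hbK⟩ := (K.positive_iff _).1 y.2
  have hA : 0 < a.num.toNat * b.den := by
    have := Rat.num_pos.2 ha
    exact Nat.mul_pos (by omega) b.den_pos
  have hB : 0 < b.num.toNat * a.den := by
    have := Rat.num_pos.2 hb
    exact Nat.mul_pos (by omega) a.den_pos
  set A := a.num.toNat * b.den with hAdef
  set B := b.num.toNat * a.den with hBdef
  have hD : (0 : ℚ) < a.den * b.den := by
    have := a.den_pos
    have := b.den_pos
    positivity
  have haA : a = A / (a.den * b.den) := by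
    have h1 : ((a.num.toNat : ℕ) : ℚ) = a.num := by
      have := Int.toNat_of_nonneg (Rat.num_pos.2 ha).le
      exact_mod_cast this
    have h2 := Rat.mul_den_eq_num a
    rw [hAdef, eq_div_iff hD.ne']
    push_cast
    rw [h1, ← h2]
    ring
  have hbB : b = B / (a.den * b.den) := by
    have h1 : ((b.num.toNat : ℕ) : ℚ) = b.num := by
      have := Int.toNat_of_nonneg (Rat.num_pos.2 hb).le
      exact_mod_cast this
    have h2 := Rat.mul_den_eq_num b
    rw [hBdef, eq_div_iff hD.ne']
    push_cast
    rw [h1, ← h2]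
    ring
  have hg : 0 < Nat.gcd A B := Nat.gcd_pos_of_pos_left _ hA
  obtain ⟨m, hm⟩ := Nat.gcd_dvd_left A B
  obtain ⟨n, hn⟩ := Nat.gcd_dvd_right A B
  have hm0 : 0 < m := Nat.pos_of_ne_zero (by rintro rfl; omega)
  have hn0 : 0 < n := Nat.pos_of_ne_zero (by rintro rfl; omega)
  set c : ℚ := (Nat.gcd A B : ℚ) / (a.den * b.den) with hc
  have hc0 : 0 < c := div_pos (by exact_mod_cast hg) hD
  have hcK : Qmax.ofRat c ∈ K.toSubsemiring := by
    have hbez : (Nat.gcd A B : ℚ) = Nat.gcdA A B * A + Nat.gcdB A B * B := by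
      have := Nat.gcd_eq_gcd_ab A B
      have h2 : ((Nat.gcd A B : ℤ) : ℚ) = ((A * Nat.gcdA A B + B * Nat.gcdB A B : ℤ) : ℚ) := by
        rw [this]
      push_cast at h2
      rw [h2]
      ring
    have : c = Nat.gcdA A B * a + Nat.gcdB A B * b := by
      rw [hc, hbez, add_div, mul_div_assoc, mul_div_assoc, ← haA, ← hbB]
    rw [this, ← Qmax.ofRat_mul]
    exact mul_mem (K.ofRat_int_mul_mem _ haK _) (K.ofRat_int_mul_mem _ hbK _)
  refine ⟨⟨Qmax.ofRat c, (K.positive_iff _).2 ⟨c, hc0, rfl, hcK⟩⟩, ⟨m, hm0⟩, ⟨n, hn0⟩,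
    Subtype.ext ?_, Subtype.ext ?_⟩
  · change Qmax.ofRat c ^ m = x.1
    rw [hax, Qmax.ofRat_pow]
    congr 1
    rw [haA, hc]
    have : (A : ℚ) = Nat.gcd A B * m := by exact_mod_cast hm
    conv_rhs => rw [this]
    ring
  · change Qmax.ofRat c ^ n = y.1
    rw [hby, Qmax.ofRat_pow]
    congr 1
    rw [hbB, hc]
    have : (B : ℚ) = Nat.gcd A B * n := by exact_mod_cast hn
    conv_rhs => rw [this]
    ring

theorem pow_right_injective (x : K.PositivePart) (m n : ℕ+) (h : x.pow m = x.pow n) :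
    m = n := by
  obtain ⟨a, ha, hax, -⟩ := (K.positive_iff _).1 x.2
  have h1 : x.1 ^ (m : ℕ) = x.1 ^ (n : ℕ) := congrArg Subtype.val h
  rw [hax, Qmax.ofRat_pow, Qmax.ofRat_pow] at h1
  have h2 := mul_right_cancel₀ ha.ne' (Qmax.ofRat_injective h1)
  exact PNat.coe_injective (by exact_mod_cast h2)

instance : IsCofiltered K.positiveFunctor.Elements where
  cone_objs X Y := by
    obtain ⟨z, m, n, h1, h2⟩ := K.exists_common_root X.2 Y.2
    exact ⟨⟨SingleObj.star ℕ+, z⟩, ⟨m, h1⟩, ⟨n, h2⟩, trivial⟩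
  cone_maps X Y f g := by
    have : f = g := Subtype.ext (K.pow_right_injective X.2 f.1 g.1 (f.2.trans g.2.symm))
    exact ⟨X, 𝟙 X, by rw [this]⟩
  nonempty := ⟨⟨SingleObj.star ℕ+, ⟨Qmax.ofRat 1, (K.positive_iff _).2
    ⟨1, one_pos, rfl, K.Zmax_le' _ (Or.inr ⟨1, by simp⟩)⟩⟩⟩⟩

/-- The point of the site `NCat` (with the trivial topology) associated to `K`. -/
def sitePoint : (⊥ : GrothendieckTopology NCat).Point where
  fiber := K.positiveFunctor
  initiallySmall := initiallySmall_of_essentiallySmall _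
  jointly_surjective {X} R hR x := by
    obtain rfl : R = ⊤ := by simpa using hR
    exact ⟨X, 𝟙 _, by simp, x, by simp⟩

/-- The point of the topos of presheaves on `NCat` associated to `K`. Its inverse image functor
restricts to `positiveFunctor` on the representable presheaf. -/
def point : ToposPoint NCat := ToposPoint.ofSite K.sitePoint

/-- The germ at `x` of a section `n` of the structure sheaf. -/
def germ (x : K.PositivePart) (n : Nbar) : K.point.Stalk structureSheaf :=
  K.sitePoint.toPresheafFiber (SingleObj.star ℕ+) x (underlying structureSheaf) n

end IntermediateSemifield

end

/-! The stalk is a colimit of copies of `Nbar` indexed by the elements of the functor K_{>1}, where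
the germ at x of k·n is identified with the germ at x^k of n. The assignment (x, n) ↦ x^{-n}, ∞ ↦ 0
respects this identification because x^{-kn} = (x^k)^{-n}, so it descends to the stalk. Any two
elements of K_{>1} have a common root, so any two elements of the stalk are germs at one and the
same x (`exists_germ₂`). Compatibility with the operations and injectivity can therefore be checked
at a fixed x. There, taking germs is a semiring homomorphism, since the operations of the stalk are
images under p^* of those of the sheaf. Moreover n ↦ x^{-n} is one because x^{-1} ≤ 1 turns inf into
max, and it is injective because x ≠ 1. For surjectivity, an r in O_K other than 0 and 1 has r^{-1}
in K_{>1}, and it is the value of the germ at r^{-1} of the integer 1. -/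

noncomputable section

/-! ### Germs at a point and the semiring structure of the stalk -/

namespace ToposPoint

variable {C : Type} [SmallCategory C] (Φ : (⊥ : GrothendieckTopology C).Point)
  (R : Cᵒᵖ ⥤ CommSemiRingCat.{0}) (X : C) (x : Φ.fiber.obj X)

theorem gen_toPresheafFiber {G : Cᵒᵖ ⥤ Type} (s : G.obj (op X)) (f : G ⟶ underlying R) :
    Stalk.gen (ofSite Φ) (Φ.toPresheafFiber X x G s) f =
      Φ.toPresheafFiber X x (underlying R) (f.app (op X) s) :=
  ConcreteCategory.congr_hom (Φ.toPresheafFiber_naturality f X x) s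

/-- Taking the germ of a section is a homomorphism of semirings. -/
def germHom : R.obj (op X) →+* (ofSite Φ).Stalk R where
  toFun s := Φ.toPresheafFiber X x (underlying R) s
  map_zero' := by
    -- The element of p^*(R) fed to the constant morphism is immaterial; the germ of 0 is just one
    -- at hand, here and for the unit.
    rw [Stalk.zero_eq_gen (p := ofSite Φ) (Φ.toPresheafFiber X x (underlying R)
      (0 : R.obj (op X))), gen_toPresheafFiber]
    rfl
  map_one' := by
    rw [Stalk.one_eq_gen (p := ofSite Φ) (Φ.toPresheafFiber X x (underlying R)
      (0 : R.obj (op X))), gen_toPresheafFiber]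
    rfl
  map_add' a b := by
    -- The germs of a and b are the two projections of the germ of the pair, so their sum is the
    -- germ at x of the sum of the pair.
    let z : (underlying R ⊗ underlying R).obj (op X) := (a, b)
    have ha := gen_toPresheafFiber Φ R X x z (fst _ _)
    have hb := gen_toPresheafFiber Φ R X x z (snd _ _)
    have hab := Stalk.gen_add (p := ofSite Φ) (Φ.toPresheafFiber X x
      (underlying R ⊗ underlying R) z)
      (fst (underlying R) (underlying R)) (snd _ _)
    rw [ha, hb, gen_toPresheafFiber] at hab
    exact hab.symm
  map_mul' a b := by
    let z : (underlying R ⊗ underlying R).obj (op X) := (a, b)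
    have ha := gen_toPresheafFiber Φ R X x z (fst _ _)
    have hb := gen_toPresheafFiber Φ R X x z (snd _ _)
    have hab := Stalk.gen_mul (p := ofSite Φ) (Φ.toPresheafFiber X x
      (underlying R ⊗ underlying R) z)
      (fst (underlying R) (underlying R)) (snd _ _)
    rw [ha, hb, gen_toPresheafFiber] at hab
    exact hab.symm

end ToposPoint

/-! ### Powers of an element as a function on ℕ ∪ {∞} -/

namespace Nbar

theorem eq_zero_or_exists (a : Nbar) : a = 0 ∨ ∃ n : ℕ, a = Tropical.trop (n : WithTop ℕ) := by
  induction a using Tropical.tropRec with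
  | h a =>
    rcases a with _ | n
    · exact Or.inl rfl
    · exact Or.inr ⟨n, rfl⟩

theorem trop_mul_trop (m n : ℕ) : (Tropical.trop (m : WithTop ℕ) : Nbar) *
    Tropical.trop (n : WithTop ℕ) = Tropical.trop ((m + n : ℕ) : WithTop ℕ) := rfl

theorem trop_add_trop (m n : ℕ) : (Tropical.trop (m : WithTop ℕ) : Nbar) +
    Tropical.trop (n : WithTop ℕ) = Tropical.trop ((min m n : ℕ) : WithTop ℕ) := rfl

theorem scale_trop (k : ℕ+) (n : ℕ) : scale k (Tropical.trop (n : WithTop ℕ)) =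
    Tropical.trop ((k * n : ℕ) : WithTop ℕ) := by
  change Tropical.trop ((k : ℕ) • (n : WithTop ℕ)) = _
  rw [nsmul_eq_mul]
  rfl

/-- The function on `ℕ ∪ {∞}` which sends `n` to `y ^ n` and `∞` to zero. -/
def powFun (y : Qmax) (a : Nbar) : Qmax :=
  WithTop.recTopCoe (C := fun _ => Qmax) 0 (fun n => y ^ n) (Tropical.untrop a)

theorem powFun_zero (y : Qmax) : powFun y 0 = 0 := rfl

theorem powFun_trop (y : Qmax) (n : ℕ) : powFun y (Tropical.trop (n : WithTop ℕ)) = y ^ n := rfl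

/-- The hypothesis says y ≤ 1, so the powers of y decrease and the maximum of two of them has the
smaller exponent. This is where inf on exponents becomes max on values. -/
theorem pow_add_pow_of_add_one {y : Qmax} (hy : y + 1 = 1) (m n : ℕ) :
    y ^ m + y ^ n = y ^ min m n := by
  have key (k : ℕ) : y ^ k + 1 = 1 := by
    induction k with
    | zero => exact max_self (α := WithBot ℚ) _
    | succ k ih =>
      calc y ^ (k + 1) + 1 = y ^ (k + 1) + (y + 1) := by rw [hy]
        _ = (y ^ k + 1) * y + 1 := by ring
        _ = 1 := by rw [ih, one_mul, hy]
  have le {m n : ℕ} (h : m ≤ n) : y ^ n + y ^ m = y ^ m := by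
    obtain ⟨k, rfl⟩ := Nat.exists_eq_add_of_le h
    calc y ^ (m + k) + y ^ m = y ^ m * (y ^ k + 1) := by ring
      _ = y ^ m := by rw [key, mul_one]
  rcases le_total m n with h | h
  · rw [min_eq_left h, add_comm, le h]
  · rw [min_eq_right h, le h]

/-- For `y ≤ 1` the function `n ↦ y ^ n`, `∞ ↦ 0` is a homomorphism of semirings. -/
def powHom (y : Qmax) (hy : y + 1 = 1) : Nbar →+* Qmax where
  toFun := powFun y
  map_zero' := rfl
  map_one' := pow_zero y
  map_add' a b := by
    rcases eq_zero_or_exists a with rfl | ⟨m, rfl⟩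
    · rw [zero_add, powFun_zero, zero_add]
    rcases eq_zero_or_exists b with rfl | ⟨n, rfl⟩
    · rw [add_zero, powFun_zero, add_zero]
    rw [trop_add_trop, powFun_trop, powFun_trop, powFun_trop, pow_add_pow_of_add_one hy]
  map_mul' a b := by
    rcases eq_zero_or_exists a with rfl | ⟨m, rfl⟩
    · rw [zero_mul, powFun_zero, zero_mul]
    rcases eq_zero_or_exists b with rfl | ⟨n, rfl⟩
    · rw [mul_zero, powFun_zero, mul_zero]
    rw [trop_mul_trop, powFun_trop, powFun_trop, powFun_trop, pow_add]

/-- This is y^{kn} = (y^k)^n, the source of the compatibility that lets values pass to the stalk. -/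
theorem powFun_scale (y : Qmax) (k : ℕ+) (a : Nbar) :
    powFun y (scale k a) = powFun (y ^ (k : ℕ)) a := by
  rcases eq_zero_or_exists a with rfl | ⟨n, rfl⟩
  · rw [map_zero, powFun_zero, powFun_zero]
  · rw [scale_trop, powFun_trop, powFun_trop, pow_mul]

end Nbar

/-! ### The evaluation (x, n) ↦ x^{-n} at a fixed x -/

namespace IntermediateSemifield

variable {K : IntermediateSemifield}

theorem PositivePart.inv_add_one (x : K.PositivePart) : x.1⁻¹ + 1 = 1 := by
  obtain ⟨q, hq, hx, -⟩ := (K.positive_iff _).1 x.2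
  rw [hx, Qmax.ofRat_inv, Qmax.one_def, Qmax.ofRat_add, max_eq_right (by linarith)]

theorem PositivePart.powFun_inv_mem (x : K.PositivePart) (a : Nbar) :
    Nbar.powFun x.1⁻¹ a ∈ K.integers := by
  rcases Nbar.eq_zero_or_exists a with rfl | ⟨n, rfl⟩
  · exact zero_mem _
  · exact pow_mem (⟨K.inv_mem' _ x.2.1, x.inv_add_one⟩ : x.1⁻¹ ∈ K.integers) n

/-- Additively x is a rational q > 0, so the values -nq are pairwise distinct, and none of them is
-∞, the value at ∞. -/
theorem PositivePart.powFun_inv_injective (x : K.PositivePart) :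
    Function.Injective (Nbar.powFun x.1⁻¹) := by
  obtain ⟨q, hq, hx, -⟩ := (K.positive_iff _).1 x.2
  intro a b h
  rw [hx, Qmax.ofRat_inv] at h
  rcases Nbar.eq_zero_or_exists a with rfl | ⟨m, rfl⟩ <;>
    rcases Nbar.eq_zero_or_exists b with rfl | ⟨n, rfl⟩
  · rfl
  · rw [Nbar.powFun_zero, Nbar.powFun_trop, Qmax.ofRat_pow] at h
    exact absurd h.symm (Qmax.ofRat_ne_zero _)
  · rw [Nbar.powFun_zero, Nbar.powFun_trop, Qmax.ofRat_pow] at h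
    exact absurd h (Qmax.ofRat_ne_zero _)
  · rw [Nbar.powFun_trop, Nbar.powFun_trop, Qmax.ofRat_pow, Qmax.ofRat_pow] at h
    have h1 := mul_right_cancel₀ (neg_ne_zero.2 hq.ne') (Qmax.ofRat_injective h)
    rw [Nat.cast_injective h1]

theorem PositivePart.powFun_inv_scale (x : K.PositivePart) (k : ℕ+) (a : Nbar) :
    Nbar.powFun x.1⁻¹ (Nbar.scale k a) = Nbar.powFun (x.pow k).1⁻¹ a :=
  (Nbar.powFun_scale _ k a).trans (congrArg (Nbar.powFun · a) (inv_pow x.1 k))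

/-! ### The isomorphism from the stalk to O_K -/

variable (K)

/-- The germ at `x`, as a homomorphism of semirings. -/
def germHom (x : K.PositivePart) : Nbar →+* K.point.Stalk structureSheaf :=
  ToposPoint.germHom K.sitePoint structureSheaf (SingleObj.star ℕ+) x

theorem germHom_apply (x : K.PositivePart) (a : Nbar) : K.germHom x a = K.germ x a := rfl

/-- Cofilteredness of the category of elements, that is, the existence of common roots in K_{>1},
brings two germs to a common x. -/
theorem exists_germ₂ (s t : K.point.Stalk structureSheaf) :
    ∃ (x : K.PositivePart) (a b : Nbar), K.germ x a = s ∧ K.germ x b = t := by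
  obtain ⟨X, x, a, b, ha, hb⟩ :=
    K.sitePoint.toPresheafFiber_jointly_surjective₂ (P := underlying structureSheaf) s t
  exact ⟨x, a, b, ha, hb⟩

/-- The map from the stalk to `ℚ_max` which sends the germ at `x` of `n` to `x⁻¹ ^ n`. -/
def stalkValue : K.point.Stalk structureSheaf → Qmax :=
  ConcreteCategory.hom (K.sitePoint.presheafFiberDesc (P := underlying structureSheaf) (T := Qmax)
    (fun _ (x : K.PositivePart) => TypeCat.ofHom (Nbar.powFun x.1⁻¹)) (by
      -- Cocone condition: the section k·a at x and the section a at x^k must have the same value.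
      intro X Y (k : ℕ+) (x : K.PositivePart)
      ext a
      exact x.powFun_inv_scale k a))

theorem stalkValue_germ (x : K.PositivePart) (a : Nbar) :
    K.stalkValue (K.germ x a) = Nbar.powFun x.1⁻¹ a :=
  ConcreteCategory.congr_hom (K.sitePoint.toPresheafFiber_presheafFiberDesc
    (P := underlying structureSheaf) (T := Qmax)
    (fun _ (x : K.PositivePart) => TypeCat.ofHom (Nbar.powFun x.1⁻¹)) _
    (SingleObj.star ℕ+) x) a

theorem stalkValue_mem (s : K.point.Stalk structureSheaf) : K.stalkValue s ∈ K.integers := by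
  obtain ⟨x, a, -, rfl, -⟩ := K.exists_germ₂ s s
  rw [stalkValue_germ]
  exact x.powFun_inv_mem a

/-- The homomorphism from the stalk to `O_K` which sends the germ at `x` of `n` to `x⁻¹ ^ n`. -/
def stalkHom : K.point.Stalk structureSheaf →+* K.integers where
  toFun s := ⟨K.stalkValue s, K.stalkValue_mem s⟩
  map_zero' := by
    -- Used only to obtain some x, at which 0 is then a germ.
    obtain ⟨x, -⟩ := K.exists_germ₂ 0 0
    refine Subtype.ext ?_
    rw [← map_zero (K.germHom x), germHom_apply]
    exact K.stalkValue_germ x 0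
  map_one' := by
    obtain ⟨x, -⟩ := K.exists_germ₂ 0 0
    refine Subtype.ext ?_
    rw [← map_one (K.germHom x), germHom_apply]
    exact (K.stalkValue_germ x 1).trans (pow_zero _)
  map_add' s t := by
    obtain ⟨x, a, b, rfl, rfl⟩ := K.exists_germ₂ s t
    refine Subtype.ext ?_
    change K.stalkValue (K.germHom x a + K.germHom x b) =
      K.stalkValue (K.germ x a) + K.stalkValue (K.germ x b)
    rw [← map_add, germHom_apply]
    simp only [stalkValue_germ]
    exact map_add (Nbar.powHom _ x.inv_add_one) a b
  map_mul' s t := by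
    obtain ⟨x, a, b, rfl, rfl⟩ := K.exists_germ₂ s t
    refine Subtype.ext ?_
    change K.stalkValue (K.germHom x a * K.germHom x b) =
      K.stalkValue (K.germ x a) * K.stalkValue (K.germ x b)
    rw [← map_mul, germHom_apply]
    simp only [stalkValue_germ]
    exact map_mul (Nbar.powHom _ x.inv_add_one) a b

theorem stalkHom_germ (x : K.PositivePart) (a : Nbar) :
    (K.stalkHom (K.germ x a) : Qmax) = Nbar.powFun x.1⁻¹ a :=
  K.stalkValue_germ x a

theorem stalkHom_injective : Function.Injective K.stalkHom := by
  intro s t h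
  obtain ⟨x, a, b, rfl, rfl⟩ := K.exists_germ₂ s t
  have h1 := congrArg Subtype.val h
  rw [stalkHom_germ, stalkHom_germ] at h1
  rw [x.powFun_inv_injective h1]

theorem stalkHom_surjective : Function.Surjective K.stalkHom := by
  rintro ⟨r, hK, hr⟩
  by_cases h0 : r = 0
  · exact ⟨0, by rw [map_zero]; exact Subtype.ext h0.symm⟩
  -- The value 1 is set apart because its inverse is not strictly positive.
  by_cases h1 : r = 1
  · exact ⟨1, by rw [map_one]; exact Subtype.ext h1.symm⟩
  have hpos : r⁻¹ ∈ K.toSubsemiring ∧ r⁻¹ + 1 = r⁻¹ ∧ r⁻¹ ≠ 1 := by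
    refine ⟨K.inv_mem' _ hK, ?_, inv_ne_one.2 h1⟩
    -- Multiplying r ∨ 1 = 1 by r⁻¹ turns r ≤ 1 into r⁻¹ ≥ 1.
    calc r⁻¹ + 1 = r⁻¹ * (r + 1) := by rw [mul_add, inv_mul_cancel₀ h0, mul_one, add_comm]
      _ = r⁻¹ := by rw [hr, mul_one]
  let x : K.PositivePart := ⟨r⁻¹, hpos⟩
  refine ⟨K.germ x (Tropical.trop ((1 : ℕ) : WithTop ℕ)), Subtype.ext ?_⟩
  exact (K.stalkHom_germ x _).trans ((pow_one _).trans (inv_inv r))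

end IntermediateSemifield

end

theorem theorem2 (K : IntermediateSemifield) :
    ∃ e : K.point.Stalk structureSheaf ≃+* K.integers,
      ∀ (x : K.PositivePart) (n : ℕ),
        (e (K.germ x (Tropical.trop (n : WithTop ℕ))) : Qmax) = (x.1⁻¹) ^ n :=
  ⟨RingEquiv.ofBijective K.stalkHom ⟨K.stalkHom_injective, K.stalkHom_surjective⟩,
    fun x n => K.stalkHom_germ x (Tropical.trop (n : WithTop ℕ))⟩
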